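/- Let $\mathcal A$ be a unital algebra over $\mathbb C$, let $\varphi:\mathcal A\to\mathbb C$ be linear with $\varphi(1_{\mathcal A})=1$, and let $\mathcal A_1,\dots,\mathcal A_k$ be unital subalgebras of $\mathcal A$. Let $T\subseteq\mathbb R$ have $0$ as an accumulation point, and let $(\varphi_t:\mathcal A\to\mathbb C)_{t\in T}$ be linear functionals with $\varphi_t(1_{\mathcal A})=1$ such that (all limits being taken along $t\in T$, $t\neq 0$): (i) for every $t\in T$, $\mathcal A_1,\dots,\mathcal A_k$ are free with respect to $\varphi_t$, i.e. $\varphi_t(a_1\cdots a_n)=0$ whenever $n\ge 1$, $i_1\ne i_2,\ i_2\neq i_3,\dots,\ i_{n-1}\ne i_n$, $a_j\in\mathcal A_{i_j}$ and $\varphi_t(a_j)=0$ for $1\le j\le n$; (ii) $\lim_{t\to0}\varphi_t(a)=\varphi(a)$ for every $a\in\mathcal A$; (iii) the limit $\varphi'(a):=\lim_{t\to0}\frac{\varphi_t(a)-\varphi(a)}{t}$ exists for every $a\in\mathcal A$. Then $\varphi':\mathcal A\to\mathbb C$ is linear with $\varphi'(1_{\mathcal A})=0$, and $\mathcal A_1,\dots,\mathcal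 A_k$ are infinitesimally free in $(\mathcal A,\varphi,\varphi')$. That is, whenever $n\ge 1$, $i_1\ne i_2,\dots, i_{n-1}\ne i_n$, $a_j\in\mathcal A_{i_j}$ and $\varphi(a_j)=0$ for $1\le j\le n$, one has $\varphi(a_1\cdots a_n)=0$ and $$\varphi'(a_1\cdots a_n)=\Bigl(\prod_{j=1}^{(n-1)/2}\varphi(a_j\,a_{n+1-j})\Bigr)\,\varphi'(a_{(n+1)/2})$$ if $n$ is odd and $i_j=i_{n+1-j}$ for all $1\le j\le n$, while $\varphi'(a_1\cdots a_n)=0$ otherwise. Moreover, let $NC(n)$ be the set of non-crossing partitions of $\{1,\dots,n\}$, ordered by $\pi\le\rho$ iff every block of $\pi$ is contained in a block of $\rho$, with maximal element $1_n$ and Möbius function $\mathrm{M\ddot ob}$. For a block $V=\{v_1<\dots<v_m\}$ write $a_V=a_{v_1}\cdots a_{v_m}$, and put $$\kappa_n(a_1,\dots,a_n)=\sum_{\pi\in NC(n)}\mathrm{M\ddot ob}(\pi,1_n)\prod_{V\in\pi}\varphi(a_V),$$ $$\kappa_n'(a_1,\dots,a_n)=\sum_{\pi\in NC(n)}\sum_{V\in\pi}\mathrm{M\ddot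 ob}(\pi,1_n)\,\varphi'(a_V)\prod_{W\in\pi,\,W\ne V}\varphi(a_W).$$ Let $\kappa_n^{(t)}$ be defined as $\kappa_n$, with $\varphi_t$ in place of $\varphi$. Then for all $n\ge1$ and all $a_1,\dots,a_n\in\mathcal A$, $$\lim_{t\to0}\kappa_n^{(t)}(a_1,\dots,a_n)=\kappa_n(a_1,\dots,a_n),\qquad \lim_{t\to0}\frac{\kappa_n^{(t)}(a_1,\dots,a_n)-\kappa_n(a_1,\dots,a_n)}{t}=\kappa_n'(a_1,\dots,a_n).$$ -/

import Mathlib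

open Filter Topology

noncomputable section

section Freeness

variable {A : Type*} [Ring A] [Algebra ℂ A] {k : ℕ}

/-- A word of indices in which consecutive letters are different. -/
def AlternatingWord {n : ℕ} (i : Fin n → Fin k) : Prop :=
  ∀ (j : ℕ) (hj : j + 1 < n), i ⟨j, Nat.lt_of_succ_lt hj⟩ ≠ i ⟨j + 1, hj⟩

/-- Free independence of the unital subalgebras `S 0, …, S (k - 1)` with respect to the linear
functional `φ`: a product of `n ≥ 1` centred elements taken from consecutively different
subalgebras has expectation zero. -/
def IsFree (φ : A →ₗ[ℂ] ℂ) (S : Fin k → Subalgebra ℂ A) : Prop :=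
  ∀ (n : ℕ) (i : Fin n → Fin k) (a : Fin n → A), 0 < n → AlternatingWord i →
    (∀ j, a j ∈ S (i j)) → (∀ j, φ (a j) = 0) → φ (List.ofFn a).prod = 0

/-- Infinitesimal freeness of the unital subalgebras `S 0, …, S (k - 1)` with respect to
`(φ, φ')`. With letters numbered from `0`, the letter opposite to the one at position `j` in a
word of length `n` is at position `j.rev`, that is `n - 1 - j`, and the middle letter of a word of
length `2 * m + 1` is at position `m`. -/
def IsInfinitesimallyFree (φ φ' : A →ₗ[ℂ] ℂ) (S : Fin k → Subalgebra ℂ A) : Prop :=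
  ∀ (n : ℕ) (i : Fin n → Fin k) (a : Fin n → A), 0 < n → AlternatingWord i →
    (∀ j, a j ∈ S (i j)) → (∀ j, φ (a j) = 0) →
    φ (List.ofFn a).prod = 0 ∧
    (∀ (m : ℕ) (hm : n = 2 * m + 1), (∀ j, i j = i j.rev) →
      φ' (List.ofFn a).prod =
        (∏ j : Fin m, φ (a ⟨j, by omega⟩ * a (Fin.rev ⟨j, by omega⟩))) * φ' (a ⟨m, by omega⟩)) ∧
    (¬ (Odd n ∧ ∀ j, i j = i j.rev) → φ' (List.ofFn a).prod = 0)

end Freeness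

section Cumulants

/-- A partition of `Fin n` is non-crossing if there are no `p < q < r < s` such that `p, r` lie in
one block and `q, s` lie in a different block. -/
def IsNonCrossing {n : ℕ} (π : Finpartition (Finset.univ : Finset (Fin n))) : Prop :=
  ∀ V ∈ π.parts, ∀ W ∈ π.parts, ∀ p q r s : Fin n, p < q → q < r → r < s →
    p ∈ V → r ∈ V → q ∈ W → s ∈ W → V = W

/-- The set `NC(n)` of non-crossing partitions of an `n`-element linearly ordered set, with the
order inherited from `Finpartition`: `π ≤ ρ` if every block of `π` is contained in a block of
`ρ`. -/
abbrev NC (n : ℕ) : Type :=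
  {π : Finpartition (Finset.univ : Finset (Fin n)) // IsNonCrossing π}

/-- The maximal element `1_n` of `NC(n)` (for `n ≥ 1` it has exactly one block). -/
def NC.one (n : ℕ) : NC n :=
  ⟨⊤, fun V hV W hW _ _ _ _ _ _ _ _ _ _ _ => by
    have h1 := Finpartition.parts_top_subset _ hV
    have h2 := Finpartition.parts_top_subset _ hW
    rw [Finset.mem_singleton] at h1 h2
    rw [h1, h2]⟩

open Classical in
instance (n : ℕ) : Fintype (NC n) := Fintype.ofFinite _

open Classical in
instance (n : ℕ) : LocallyFiniteOrder (NC n) := Fintype.toLocallyFiniteOrder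

open Classical in
/-- The value `Möb(π, 1_n)` of the Möbius function of the poset `NC(n)`. -/
def mobToOne {n : ℕ} (π : NC n) : ℂ :=
  IncidenceAlgebra.mu ℂ π (NC.one n)

variable {A : Type*} [Ring A] [Algebra ℂ A]

/-- The product `a_{v₁} ⋯ a_{vₘ}` over the elements `v₁ < ⋯ < vₘ` of `V`. -/
def blockProd {n : ℕ} (a : Fin n → A) (V : Finset (Fin n)) : A :=
  ((V.sort (· ≤ ·)).map a).prod

/-- The non-crossing cumulant `κ_n(a_1, …, a_n)` of `φ`. -/
def ncCumulant (φ : A →ₗ[ℂ] ℂ) {n : ℕ} (a : Fin n → A) : ℂ :=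
  ∑ π : NC n, mobToOne π * ∏ V ∈ π.1.parts, φ (blockProd a V)

/-- The infinitesimal non-crossing cumulant `κ'_n(a_1, …, a_n)` of `(φ, φ')`. -/
def infinitesimalCumulant (φ φ' : A →ₗ[ℂ] ℂ) {n : ℕ} (a : Fin n → A) : ℂ :=
  ∑ π : NC n, ∑ V ∈ π.1.parts,
    mobToOne π * φ' (blockProd a V) * ∏ W ∈ π.1.parts.erase V, φ (blockProd a W)

end Cumulants

end

/-! Letters centred under `φ` are in general not centred under `φ_t`, but the recentred word
satisfies `φ_t(∏ (a_j - φ_t(a_j))) = 0` for `t ≠ 0`. Letting `t → 0` shows that `φ` is free.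
Differentiating at `0` gives `φ'(a_1 ⋯ a_n) = ∑_j φ'(a_j) φ(a_1 ⋯ a_{j-1} a_{j+1} ⋯ a_n)`.

Removing letter `j` leaves two centred words facing each other across a gap. By
`IsFree.apply_reverse_mul` they pair off outwards from the gap, giving zero unless their labels
match. So only the middle letter of a palindromic word contributes. Cumulants are polynomials in
moments, so their limits and derivatives follow termwise. -/

/-! ### Expectations of centred words under a free functional -/

section FreeWords

variable {A : Type*} [Ring A] [Algebra ℂ A] {k : ℕ}

/-- A word of labelled elements, consecutive labels being different, each element lying in the
subalgebra given by its label and having expectation zero. -/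
def IsCenteredWord (φ : A →ₗ[ℂ] ℂ) (S : Fin k → Subalgebra ℂ A) (w : List (Fin k × A)) : Prop :=
  w.IsChain (fun x y => x.1 ≠ y.1) ∧ ∀ x ∈ w, x.2 ∈ S x.1 ∧ φ x.2 = 0

variable {φ : A →ₗ[ℂ] ℂ} {S : Fin k → Subalgebra ℂ A}

lemma IsFree.apply_prod_eq_zero (h : IsFree φ S) {w : List (Fin k × A)}
    (hw : IsCenteredWord φ S w) (hne : w ≠ []) : φ (w.map Prod.snd).prod = 0 := by
  have key := h w.length (fun j => (w.get j).1) (fun j => (w.get j).2)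
    (List.length_pos_of_ne_nil hne)
    (fun j hj => (List.isChain_iff_getElem.1 hw.1) j hj)
    (fun j => (hw.2 _ (List.get_mem w j)).1) (fun j => (hw.2 _ (List.get_mem w j)).2)
  have e : List.ofFn (fun j => (w.get j).2) = w.map Prod.snd := by
    apply List.ext_getElem <;> simp
  rwa [e] at key

lemma IsCenteredWord.reverse {w : List (Fin k × A)} (hw : IsCenteredWord φ S w) :
    IsCenteredWord φ S w.reverse := by
  refine ⟨List.isChain_reverse.2 (hw.1.imp fun _ _ h => h.symm), fun x hx => hw.2 x ?_⟩
  simpa using hx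

lemma IsCenteredWord.of_cons {x : Fin k × A} {w : List (Fin k × A)}
    (hw : IsCenteredWord φ S (x :: w)) : IsCenteredWord φ S w :=
  ⟨hw.1.tail, fun y hy => hw.2 y (List.mem_cons_of_mem _ hy)⟩

lemma IsCenteredWord.take {w : List (Fin k × A)} (hw : IsCenteredWord φ S w) (j : ℕ) :
    IsCenteredWord φ S (w.take j) :=
  ⟨hw.1.take j, fun x hx => hw.2 x (List.mem_of_mem_take hx)⟩

lemma IsCenteredWord.drop {w : List (Fin k × A)} (hw : IsCenteredWord φ S w) (j : ℕ) :
    IsCenteredWord φ S (w.drop j) :=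
  ⟨hw.1.drop j, fun x hx => hw.2 x (List.mem_of_mem_drop hx)⟩

lemma IsCenteredWord.replace_head {x y : Fin k × A} {w : List (Fin k × A)}
    (hw : IsCenteredWord φ S (x :: w)) (hxy : y.1 = x.1) (hy : y.2 ∈ S y.1) (h0 : φ y.2 = 0) :
    IsCenteredWord φ S (y :: w) := by
  refine ⟨?_, ?_⟩
  · have := hw.1
    rw [List.isChain_cons] at this ⊢
    rwa [hxy]
  · intro z hz
    rcases List.mem_cons.1 hz with rfl | hz
    · exact ⟨hy, h0⟩
    · exact hw.of_cons.2 z hz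

lemma IsCenteredWord.reverse_append {x y : Fin k × A} {L R : List (Fin k × A)}
    (hL : IsCenteredWord φ S (x :: L)) (hR : IsCenteredWord φ S (y :: R)) (hxy : x.1 ≠ y.1) :
    IsCenteredWord φ S ((x :: L).reverse ++ y :: R) := by
  refine ⟨List.isChain_append.2 ⟨hL.reverse.1, hR.1, ?_⟩, ?_⟩
  · simpa using hxy
  · intro z hz
    rcases List.mem_append.1 hz with hz | hz
    · exact hL.reverse.2 z hz
    · exact hR.2 z hz

/-- The two equal-labelled heads fuse into one letter. Alternation survives on the left because the
next letter of `L` already differed from the label of `x`, which is that of `y`. -/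
lemma IsCenteredWord.merge {x y : Fin k × A} {L R : List (Fin k × A)}
    (hL : IsCenteredWord φ S (x :: L)) (hR : IsCenteredWord φ S (y :: R)) (hxy : x.1 = y.1)
    {b : A} (hb : b ∈ S y.1) (h0 : φ b = 0) :
    IsCenteredWord φ S (L.reverse ++ (y.1, b) :: R) := by
  cases L with
  | nil => simpa using hR.replace_head (y := (y.1, b)) rfl hb h0
  | cons z L =>
    refine hL.of_cons.reverse_append (hR.replace_head (y := (y.1, b)) rfl hb h0) ?_
    have := (List.isChain_cons_cons.1 hL.1).1
    rw [hxy] at this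
    exact this.symm

/-- Two centred words `L`, `R` read outwards from a common centre: the expectation of the product
is a product of pairings if the labels match, and zero otherwise. -/
lemma IsFree.apply_reverse_mul (h : IsFree φ S) (h1 : φ 1 = 1) :
    ∀ {L R : List (Fin k × A)}, IsCenteredWord φ S L → IsCenteredWord φ S R →
      φ ((L.reverse.map Prod.snd).prod * (R.map Prod.snd).prod) =
        if L.map Prod.fst = R.map Prod.fst then
          (List.zipWith (fun x y : Fin k × A => φ (x.2 * y.2)) L R).prod else 0
  | [], [], _, _ => by simp [h1]
  | [], y :: R, _, hR => by simpa using h.apply_prod_eq_zero hR (by simp)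
  | x :: L, [], hL, _ => by simpa using h.apply_prod_eq_zero hL.reverse (by simp)
  | x :: L, y :: R, hL, hR => by
    by_cases hxy : x.1 = y.1
    · have ih := h.apply_reverse_mul h1 hL.of_cons hR.of_cons
      have hxS := (hL.2 x (by simp)).1
      have hyS := (hR.2 y (by simp)).1
      rw [hxy] at hxS
      -- Split the central product `x.2 * y.2` into its centred part, which freeness kills, and a
      -- scalar, which leaves the shorter pair `L`, `R`.
      have hz := h.apply_prod_eq_zero (hL.merge hR hxy
        (b := x.2 * y.2 - algebraMap ℂ A (φ (x.2 * y.2)))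
        (sub_mem (mul_mem hxS hyS) (Subalgebra.algebraMap_mem _ _))
        (by simp [Algebra.algebraMap_eq_smul_one, h1])) (by simp)
      have e : ((x :: L).reverse.map Prod.snd).prod * ((y :: R).map Prod.snd).prod =
          ((L.reverse ++ (y.1, x.2 * y.2 - algebraMap ℂ A (φ (x.2 * y.2))) :: R).map
            Prod.snd).prod +
          φ (x.2 * y.2) • ((L.reverse.map Prod.snd).prod * (R.map Prod.snd).prod) := by
        simp only [List.reverse_cons, List.map_append, List.map_cons, List.map_nil,
          List.prod_append, List.prod_cons, List.prod_nil, Algebra.algebraMap_eq_smul_one,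
          sub_mul, mul_sub, smul_mul_assoc, mul_smul_comm, one_mul, mul_one, mul_assoc]
        abel
      rw [e, map_add, hz, zero_add, map_smul, ih]
      simp [hxy]
    · have hz := h.apply_prod_eq_zero (hL.reverse_append hR hxy) (by simp)
      rw [List.map_append, List.prod_append] at hz
      rw [hz]
      simp [hxy]

end FreeWords

/-! ### Derivatives of recentred products and of cumulants -/

section Derivatives

variable {A : Type*} [Ring A] [Algebra ℂ A] {T : Set ℝ} {ψ : ℝ → A →ₗ[ℂ] ℂ} {φ' : A →ₗ[ℂ] ℂ}

/-- The derivative at `0` of the expectation under `ψ t` of a product of elements which are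
centred with respect to `ψ t`. -/
lemma hasDerivWithinAt_apply_mul_prod_centered
    (hψ : ∀ a, HasDerivWithinAt (fun t => ψ t a) (φ' a) T 0) :
    ∀ (l : List A) (x : A), (∀ b ∈ l, ψ 0 b = 0) →
      HasDerivWithinAt
        (fun t => ψ t (x * (l.map fun b => b - algebraMap ℂ A (ψ t b)).prod))
        (φ' (x * l.prod) - ∑ j : Fin l.length,
          φ' (l.get j) * ψ 0 (x * ((l.take j).prod * (l.drop (j + 1)).prod))) T 0
  | [], x, _ => by simpa using hψ x
  | b :: l, x, h0 => by
    have hb : ψ 0 b = 0 := h0 b (by simp)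
    have hl : ∀ c ∈ l, ψ 0 c = 0 := fun c hc => h0 c (by simp [hc])
    -- Expanding `b - ψ t b` either absorbs `b` into the prefix or deletes it with a scalar factor;
    -- this is why the prefix `x` is arbitrary in the induction.
    have d1 := hasDerivWithinAt_apply_mul_prod_centered hψ l (x * b) hl
    have d2 := (hψ b).mul (hasDerivWithinAt_apply_mul_prod_centered hψ l x hl)
    have el : (l.map fun c => c - algebraMap ℂ A (ψ 0 c)) = l := by
      conv_rhs => rw [← List.map_id l]
      exact List.map_congr_left fun c hc => by simp [hl c hc]
    have e : ∀ t, ψ t (x * ((b :: l).map fun b => b - algebraMap ℂ A (ψ t b)).prod) =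
        ψ t (x * b * (l.map fun b => b - algebraMap ℂ A (ψ t b)).prod) -
          ψ t b * ψ t (x * (l.map fun b => b - algebraMap ℂ A (ψ t b)).prod) := by
      intro t
      rw [← smul_eq_mul (ψ t b), ← map_smul, ← map_sub, List.map_cons, List.prod_cons, sub_mul,
        mul_sub, Algebra.algebraMap_eq_smul_one (ψ t b), smul_mul_assoc, one_mul,
        mul_smul_comm, mul_assoc]
    refine ((d1.sub d2).congr_deriv ?_).congr (fun t _ => e t) (e 0)
    rw [el, hb]
    simp only [List.prod_cons, List.length_cons, Fin.sum_univ_succ, List.get_eq_getElem,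
      Fin.val_zero, Fin.val_succ, List.getElem_cons_zero, List.getElem_cons_succ, List.take_zero,
      List.take_succ_cons, List.drop_succ_cons, List.drop_zero, List.prod_nil, one_mul, mul_assoc,
      zero_mul, add_zero]
    ring

/-- The Möbius coefficients do not depend on `t`, so the infinitesimal cumulant is exactly the
Leibniz expansion. -/
lemma hasDerivWithinAt_ncCumulant
    (hψ : ∀ a, HasDerivWithinAt (fun t => ψ t a) (φ' a) T 0) {n : ℕ} (a : Fin n → A) :
    HasDerivWithinAt (fun t => ncCumulant (ψ t) a) (infinitesimalCumulant (ψ 0) φ' a) T 0 := by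
  unfold ncCumulant infinitesimalCumulant
  refine HasDerivWithinAt.fun_sum fun π _ => ?_
  refine ((HasDerivWithinAt.fun_finsetProd (u := π.1.parts)
    fun V _ => hψ (blockProd a V)).const_mul (mobToOne π)).congr_deriv ?_
  rw [Finset.mul_sum]
  refine Finset.sum_congr rfl fun V _ => ?_
  rw [smul_eq_mul]
  ring

end Derivatives

/-! ### Infinitesimal freeness from a differentiable family -/

section InfinitesimalFreeness

variable {A : Type*} [Ring A] [Algebra ℂ A] {k : ℕ} {S : Fin k → Subalgebra ℂ A}
  {T : Set ℝ} {ψ : ℝ → A →ₗ[ℂ] ℂ} {φ' : A →ₗ[ℂ] ℂ}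

/-- Centring the letters of an alternating word gives a product of expectation zero. -/
lemma IsFree.apply_prod_sub_eq_zero {φ : A →ₗ[ℂ] ℂ} (h : IsFree φ S) (h1 : φ 1 = 1)
    {n : ℕ} (hn : 0 < n) {i : Fin n → Fin k} {a : Fin n → A} (hi : AlternatingWord i)
    (ha : ∀ j, a j ∈ S (i j)) :
    φ ((List.ofFn a).map fun b => b - algebraMap ℂ A (φ b)).prod = 0 := by
  rw [List.map_ofFn]
  refine h n i _ hn hi (fun j => sub_mem (ha j) (Subalgebra.algebraMap_mem _ _)) fun j => ?_
  simp [Algebra.algebraMap_eq_smul_one, h1]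

/-- The recentred product has expectation zero for `t ≠ 0` and is continuous at `0`, where
recentring changes nothing. -/
lemma isFree_zero_of_hasDerivWithinAt (hT : AccPt (0 : ℝ) (𝓟 T))
    (h1 : ∀ t ∈ T, t ≠ 0 → ψ t 1 = 1) (hfree : ∀ t ∈ T, t ≠ 0 → IsFree (ψ t) S)
    (hψ : ∀ a, HasDerivWithinAt (fun t => ψ t a) (φ' a) T 0) :
    IsFree (ψ 0) S := by
  have := accPt_principal_iff_nhdsWithin.1 hT
  intro n i a hn hi ha h0
  have d := hasDerivWithinAt_apply_mul_prod_centered hψ (List.ofFn a) 1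
    (by simpa [List.forall_mem_ofFn_iff] using h0)
  have c := (d.continuousWithinAt.mono (Set.sdiff_subset (t := {0}))).tendsto
  have z : Tendsto (fun t => ψ t
      (1 * ((List.ofFn a).map fun b => b - algebraMap ℂ A (ψ t b)).prod))
      (𝓝[T \ {0}] 0) (𝓝 0) := by
    refine tendsto_const_nhds.congr' ?_
    filter_upwards [self_mem_nhdsWithin] with t ht
    rw [one_mul, (hfree t ht.1 ht.2).apply_prod_sub_eq_zero (h1 t ht.1 ht.2) hn hi ha]
  have e := tendsto_nhds_unique c z
  simpa [List.map_ofFn, Function.comp_def, h0] using e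

/-- Differentiating the freeness relation of a centred alternating word. -/
lemma apply_prod_eq_sum_of_hasDerivWithinAt (hT : AccPt (0 : ℝ) (𝓟 T))
    (h1 : ∀ t ∈ T, t ≠ 0 → ψ t 1 = 1) (hfree : ∀ t ∈ T, t ≠ 0 → IsFree (ψ t) S)
    (hψ : ∀ a, HasDerivWithinAt (fun t => ψ t a) (φ' a) T 0)
    {n : ℕ} (hn : 0 < n) {i : Fin n → Fin k} {a : Fin n → A} (hi : AlternatingWord i)
    (ha : ∀ j, a j ∈ S (i j)) (h0 : ∀ j, ψ 0 (a j) = 0) :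
    φ' (List.ofFn a).prod = ∑ j : Fin n, φ' (a j) *
      ψ 0 (((List.ofFn a).take j).prod * ((List.ofFn a).drop (j + 1)).prod) := by
  have d := hasDerivWithinAt_apply_mul_prod_centered hψ (List.ofFn a) 1
    (by simpa [List.forall_mem_ofFn_iff] using h0)
  have hz := isFree_zero_of_hasDerivWithinAt hT h1 hfree hψ n i a hn hi ha h0
  have z : HasDerivWithinAt (fun t => ψ t
      (1 * ((List.ofFn a).map fun b => b - algebraMap ℂ A (ψ t b)).prod)) 0 T 0 := by
    refine (hasDerivWithinAt_const (0 : ℝ) T (0 : ℂ)).congr (fun t ht => ?_) ?_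
    · by_cases ht0 : t = 0
      · subst ht0
        simpa [List.map_ofFn, Function.comp_def, h0] using hz
      · rw [one_mul, (hfree t ht ht0).apply_prod_sub_eq_zero (h1 t ht ht0) hn hi ha]
    · simpa [List.map_ofFn, Function.comp_def, h0] using hz
  -- The same function has the Leibniz derivative and, vanishing on `T` and at `0`, the derivative
  -- zero; accumulation at `0` makes the two agree.
  have e := hT.uniqueDiffWithinAt.eq_deriv _ d z
  rw [sub_eq_zero, one_mul] at e
  rw [e]
  refine Fintype.sum_equiv (finCongr (List.length_ofFn)) _ _ fun j => ?_
  rw [List.get_ofFn, one_mul]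
  rfl

lemma isInfinitesimallyFree_of_hasDerivWithinAt (hT : AccPt (0 : ℝ) (𝓟 T))
    (h1 : ∀ t ∈ T, t ≠ 0 → ψ t 1 = 1) (h10 : ψ 0 1 = 1)
    (hfree : ∀ t ∈ T, t ≠ 0 → IsFree (ψ t) S)
    (hψ : ∀ a, HasDerivWithinAt (fun t => ψ t a) (φ' a) T 0) :
    IsInfinitesimallyFree (ψ 0) φ' S := by
  intro n i a hn hi ha h0
  have hF := isFree_zero_of_hasDerivWithinAt hT h1 hfree hψ
  have hsum := apply_prod_eq_sum_of_hasDerivWithinAt hT h1 hfree hψ hn hi ha h0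
  set w : List (Fin k × A) := List.ofFn fun j => (i j, a j) with hw
  have hwc : IsCenteredWord (ψ 0) S w := by
    refine ⟨List.isChain_ofFn.2 hi, ?_⟩
    rw [hw, List.forall_mem_ofFn_iff]
    exact fun j => ⟨ha j, h0 j⟩
  have hwa : List.ofFn a = w.map Prod.snd := by rw [hw, List.map_ofFn]; rfl
  have hterm : ∀ j : Fin n,
      ψ 0 (((List.ofFn a).take j).prod * ((List.ofFn a).drop (j + 1)).prod) =
      if (w.take j).reverse.map Prod.fst = (w.drop (j + 1)).map Prod.fst then
        (List.zipWith (fun x y : Fin k × A => ψ 0 (x.2 * y.2))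
          (w.take j).reverse (w.drop (j + 1))).prod else 0 := by
    intro j
    rw [← hF.apply_reverse_mul h10 (hwc.take j).reverse (hwc.drop (j + 1)), List.reverse_reverse,
      hwa, List.map_take, List.map_drop]
  have hlen : ∀ j : Fin n,
      (w.take j).reverse.map Prod.fst = (w.drop (j + 1)).map Prod.fst → n = 2 * j + 1 := by
    intro j hj
    have := congrArg List.length hj
    simp [hw] at this
    omega
  have hpal : ∀ j : Fin n, n = 2 * j + 1 →
      ((w.take j).reverse.map Prod.fst = (w.drop (j + 1)).map Prod.fst ↔
        ∀ p, i p = i p.rev) := by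
    intro j hj
    constructor
    · intro h
      have hs : ∀ (p : Fin n), p.1 < j.1 → i p = i p.rev := by
        intro p hp
        have h2 := List.getElem_of_eq h (i := j.1 - 1 - p.1) (by simp [hw]; omega)
        simp only [hw, List.getElem_map, List.getElem_reverse, List.getElem_take,
          List.getElem_drop, List.getElem_ofFn, List.length_take, List.length_ofFn] at h2
        convert h2 using 2
        · ext; simp only; omega
        · ext; simp only [Fin.val_rev]; omega
      intro p
      rcases lt_trichotomy p.1 j.1 with hp | hp | hp
      · exact hs p hp
      · congr 1
        ext
        simp only [Fin.val_rev]
        omega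
      · have := hs p.rev (by simp only [Fin.val_rev]; omega)
        rw [Fin.rev_rev] at this
        exact this.symm
    · intro h
      apply List.ext_getElem
      · simp [hw]; omega
      · intro s hs1 hs2
        simp [hw] at hs1 hs2 ⊢
        rw [h]
        congr 1
        ext
        simp only [Fin.val_rev]
        omega
  refine ⟨hF n i a hn hi ha h0, ?_, ?_⟩
  · intro m hm hp
    rw [hsum, Finset.sum_eq_single (⟨m, by omega⟩ : Fin n)]
    · rw [hterm, if_pos ((hpal _ hm).2 hp), mul_comm]
      congr 1
      -- The pairing runs outwards from the centre, the target product inwards from the ends; hence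
      -- the reversed index.
      have e : List.zipWith (fun x y : Fin k × A => ψ 0 (x.2 * y.2))
          (w.take m).reverse (w.drop (m + 1)) =
          List.ofFn (fun s : Fin m => ψ 0 (a ⟨s.rev, by omega⟩ * a (Fin.rev ⟨s.rev, by omega⟩))) := by
        apply List.ext_getElem
        · simp [hw]; omega
        · intro s hs1 hs2
          simp [hw] at hs1 hs2 ⊢
          congr 3
          · exact Fin.ext (by dsimp only; omega)
          · ext; simp only [Fin.val_rev]; omega
      rw [e, List.prod_ofFn]
      exact Equiv.prod_comp Fin.revPerm
        (fun j : Fin m => ψ 0 (a ⟨j, by omega⟩ * a (Fin.rev ⟨j, by omega⟩)))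
    · intro j _ hj
      rw [hterm, if_neg, mul_zero]
      intro h
      exact hj (Fin.ext (by have := hlen j h; simp only; omega))
    · simp
  · intro hno
    rw [hsum]
    refine Finset.sum_eq_zero fun j _ => ?_
    rw [hterm, if_neg, mul_zero]
    intro h
    exact hno ⟨⟨j, hlen j h⟩, (hpal j (hlen j h)).1 h⟩

end InfinitesimalFreeness

/-! ### From limits of difference quotients to derivatives -/

theorem proposition1p5 {A : Type*} [Ring A] [Algebra ℂ A] {k : ℕ}
    (S : Fin k → Subalgebra ℂ A)
    (φ : A →ₗ[ℂ] ℂ) (hφ : φ 1 = 1)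
    (T : Set ℝ) (hT : AccPt (0 : ℝ) (𝓟 T))
    (φt : ℝ → A →ₗ[ℂ] ℂ) (hφt : ∀ t ∈ T, φt t 1 = 1)
    (hfree : ∀ t ∈ T, IsFree (φt t) S)
    (hlim : ∀ a : A, Tendsto (fun t : ℝ => φt t a) (𝓝[T \ {0}] 0) (𝓝 (φ a)))
    (hderiv : ∀ a : A, ∃ l : ℂ,
      Tendsto (fun t : ℝ => (φt t a - φ a) / (t : ℂ)) (𝓝[T \ {0}] 0) (𝓝 l)) :
    ∃ φ' : A →ₗ[ℂ] ℂ,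
      (∀ a : A,
        Tendsto (fun t : ℝ => (φt t a - φ a) / (t : ℂ)) (𝓝[T \ {0}] 0) (𝓝 (φ' a))) ∧
      φ' 1 = 0 ∧
      IsInfinitesimallyFree φ φ' S ∧
      ∀ (n : ℕ), 1 ≤ n → ∀ a : Fin n → A,
        Tendsto (fun t : ℝ => ncCumulant (φt t) a) (𝓝[T \ {0}] 0) (𝓝 (ncCumulant φ a)) ∧
        Tendsto (fun t : ℝ => (ncCumulant (φt t) a - ncCumulant φ a) / (t : ℂ))
          (𝓝[T \ {0}] 0) (𝓝 (infinitesimalCumulant φ φ' a)) := by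
  have : (𝓝[T \ {0}] (0 : ℝ)).NeBot := accPt_principal_iff_nhdsWithin.1 hT
  choose f hf using hderiv
  let φ' : A →ₗ[ℂ] ℂ :=
    { toFun := f
      map_add' := fun a b => tendsto_nhds_unique (hf (a + b)) <|
        ((hf a).add (hf b)).congr fun t => by rw [map_add, map_add]; ring
      map_smul' := fun c a => tendsto_nhds_unique (hf (c • a)) <|
        ((hf a).const_mul c).congr fun t => by
          rw [map_smul, map_smul, smul_eq_mul, smul_eq_mul]; ring }
  -- The value `φt 0` is not tied to `φ`; overwriting it turns the hypotheses into differentiability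
  -- at `0` within `T`.
  let ψ : ℝ → A →ₗ[ℂ] ℂ := Function.update φt 0 φ
  have hψ0 : ψ 0 = φ := Function.update_self ..
  have hψt : ∀ t, t ≠ 0 → ψ t = φt t := fun t ht => Function.update_of_ne ht ..
  have slope_eq : ∀ F : (A →ₗ[ℂ] ℂ) → ℂ,
      (fun t : ℝ => (F (φt t) - F φ) / (t : ℂ)) =ᶠ[𝓝[T \ {0}] 0]
        slope (fun t => F (ψ t)) 0 := by
    intro F
    filter_upwards [self_mem_nhdsWithin] with t ht
    rw [slope_def_module, hψ0, hψt t ht.2, sub_zero, Complex.real_smul, Complex.ofReal_inv,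
      div_eq_inv_mul]
  have hψ : ∀ a, HasDerivWithinAt (fun t => ψ t a) (φ' a) T 0 := fun a =>
    hasDerivWithinAt_iff_tendsto_slope.2 ((hf a).congr' (slope_eq fun χ => χ a))
  have h1 : ∀ t ∈ T, t ≠ 0 → ψ t 1 = 1 := fun t ht h => by rw [hψt t h, hφt t ht]
  have hfr : ∀ t ∈ T, t ≠ 0 → IsFree (ψ t) S := fun t ht h => by
    rw [hψt t h]; exact hfree t ht
  refine ⟨φ', hf, ?_, ?_, fun n _ a => ⟨?_, ?_⟩⟩
  · refine tendsto_nhds_unique (hf 1) (tendsto_const_nhds.congr' ?_)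
    filter_upwards [self_mem_nhdsWithin] with t ht
    rw [hφt t ht.1, hφ, sub_self, zero_div]
  · rw [← hψ0]
    exact isInfinitesimallyFree_of_hasDerivWithinAt hT h1 (hψ0 ▸ hφ) hfr hψ
  · exact tendsto_finsetSum _ fun π _ =>
      (tendsto_finsetProd _ fun V _ => hlim (blockProd a V)).const_mul _
  · have d := hasDerivWithinAt_ncCumulant hψ a
    rw [hψ0] at d
    exact (hasDerivWithinAt_iff_tendsto_slope.1 d).congr' (slope_eq fun χ => ncCumulant χ a).symm
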